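/- Let $X_1,\dots,X_p$ be independent random elements of probability spaces $\mathcal X_1,\dots,\mathcal X_p$, let $X=(X_1,\dots,X_p)$, let $f:\mathcal X_1\times\dots\times\mathcal X_p\to\mathbb R$ be measurable, and let $Y=f(X)$ be square integrable with $V:=\operatorname{Var}Y\neq 0$. Let $X'$ be an independent copy of $X$. For $a\subseteq\{1,\dots,p\}$ let $X^{a}_i=X_i$ if $i\in a$ and $X^{a}_i=X'_i$ if $i\notin a$, put $Y^{a}=f(X^{a})$, and let $$S^{a}=\frac{\operatorname{Var}\big(\mathbb E(Y\mid X_i,\ i\in a)\big)}{\operatorname{Var}Y}$$ be the closed Sobol index of $a$. Let $(X_n,X'_n)_{n\ge 1}$ be independent copies of $(X,X')$, let $Y_n$, $Y_n^{a}$ be the corresponding copies of $Y$, $Y^a$ (the same $X'_n$ being used for all $a$), and let $$S^{a}_N=\frac{\frac1N\sum_{n\le N} Y_nY_n^{a}-\big(\frac1N\sum_{n\le N} Y_n\big)\big(\frac1N\sum_{n\le N} Y_n^{a}\big)}{\frac1N\sum_{n\le N} Y_n^2-\big(\frac1N\sum_{n\le N} Y_n\big)^2}$$ (with the convention that a quotient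 with zero denominator is $0$). For a tuple $\mathbf t=(t_1,\dots,t_m)$ of subsets of $\{1,\dots,p\}$ write $S^{\mathbf t}=(S^{t_1},\dots,S^{t_m})$ and $S^{\mathbf t}_N=(S^{t_1}_N,\dots,S^{t_m}_N)$. Let $\mathbf u=(u_1,\dots,u_k)$, $\mathbf v=(v_1,\dots,v_l)$, $\mathbf w=(w_1,\dots,w_l)$ be tuples of subsets of $\{1,\dots,p\}$. Let $H_0$ be the hypothesis "$S^{\mathbf u}=0$ and $S^{\mathbf v}=S^{\mathbf w}$", and let $H_1$ be its negation. Put $$\widetilde G_N=\sqrt N\begin{pmatrix}S_N^{\mathbf u}\\ S_N^{\mathbf v}-S_N^{\mathbf w}\end{pmatrix}\in\mathbb R^{k+l},\qquad \widetilde G_N(1)=\sqrt N\,S_N^{\mathbf u}\in\mathbb R^k,\qquad \widetilde G_N(2)=\sqrt N\,(S_N^{\mathbf v}-S_N^{\mathbf w})\in\mathbb R^l .$$ Let $\Gamma=A\Sigma A^{\mathsf T}$, where $A:\mathbb R^{k+l+l}\to\mathbb R^{k+l}$ is the linear map $(a,b,c)\mapsto(a,b-c)$ and $\Sigma$ is the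 matrix indexed by the entries of the concatenated tuple $\mathbf t=(\mathbf u,\mathbf v,\mathbf w)$, with $$\Sigma_{ij}=\frac{\operatorname{Cov}(\bar Y\bar Y^{t_i},\bar Y\bar Y^{t_j})-S^{t_i}\operatorname{Cov}(\bar Y\bar Y^{t_j},\bar Y^2)-S^{t_j}\operatorname{Cov}(\bar Y\bar Y^{t_i},\bar Y^2)+S^{t_i}S^{t_j}\operatorname{Var}(\bar Y^2)}{V^2},$$ where $\bar Y=Y-\mathbb EY$ and $\bar Y^{a}=Y^{a}-\mathbb EY^{a}$. (i) If $\mathbb E(Y^4)<\infty$, then $\Gamma$ is positive semidefinite and, under $H_0$, $\widetilde G_N$ converges in law, as $N\to\infty$, to $\mathcal N_{k+l}(0,\Gamma)$. (ii) Under $H_1$, $|\widetilde G_N(1)|+|\widetilde G_N(2)|\to\infty$ almost surely as $N\to\infty$, where $|\cdot|$ is the Euclidean norm. -/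

import Mathlib

open MeasureTheory ProbabilityTheory Filter Topology

namespace SobolTest

noncomputable section

section Model

variable {p : ℕ} {𝒳 : Fin p → Type*}

/-- The pick-freeze vector: the coordinates in `u` are frozen to those of `x`, the other ones are
taken from `x'`. -/
def pickFreeze (u : Finset (Fin p)) (x x' : ∀ i, 𝒳 i) : ∀ i, 𝒳 i :=
  fun i => if i ∈ u then x i else x' i

/-- The empirical mean of the first `N` terms of a sequence. -/
def empMean (N : ℕ) (z : ℕ → ℝ) : ℝ :=
  (1 / (N : ℝ)) * ∑ n ∈ Finset.range N, z n

/-- The pick-freeze estimator of the closed Sobol index of `u`, computed from the values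
`Y n = f (x n)` and `Y^u n = f (pickFreeze u (x n) (x' n))` for `n < N`. -/
def sobolEstimator (f : (∀ i, 𝒳 i) → ℝ) (u : Finset (Fin p)) (x x' : ℕ → ∀ i, 𝒳 i) (N : ℕ) : ℝ :=
  (empMean N (fun n => f (x n) * f (pickFreeze u (x n) (x' n)))
      - empMean N (fun n => f (x n)) * empMean N (fun n => f (pickFreeze u (x n) (x' n))))
    / (empMean N (fun n => f (x n) ^ 2) - empMean N (fun n => f (x n)) ^ 2)

/-- The test statistic `√N (S_N^u, S_N^v - S_N^w)`, a vector of `ℝ^(k+l)`. -/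
def testStatistic {k l : ℕ} (f : (∀ i, 𝒳 i) → ℝ) (u : Fin k → Finset (Fin p))
    (v w : Fin l → Finset (Fin p)) (x x' : ℕ → ∀ i, 𝒳 i) (N : ℕ) :
    EuclideanSpace ℝ (Fin k ⊕ Fin l) :=
  WithLp.toLp 2 (Sum.elim
    (fun a => √(N : ℝ) * sobolEstimator f (u a) x x' N)
    (fun b => √(N : ℝ) * (sobolEstimator f (v b) x x' N - sobolEstimator f (w b) x x' N)))

/-- The first block (in `ℝ^k`) of a vector of `ℝ^(k+l)`. -/
def firstBlock {k l : ℕ} (g : EuclideanSpace ℝ (Fin k ⊕ Fin l)) : EuclideanSpace ℝ (Fin k) :=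
  WithLp.toLp 2 (fun a => g (Sum.inl a))

/-- The second block (in `ℝ^l`) of a vector of `ℝ^(k+l)`. -/
def secondBlock {k l : ℕ} (g : EuclideanSpace ℝ (Fin k ⊕ Fin l)) : EuclideanSpace ℝ (Fin l) :=
  WithLp.toLp 2 (fun b => g (Sum.inr b))

variable [∀ i, MeasurableSpace (𝒳 i)]

/-- The law of the input `X = (X_1, …, X_p)`, whose components are independent with `X_i ∼ μ i`. -/
def inputLaw (μ : ∀ i, Measure (𝒳 i)) : Measure (∀ i, 𝒳 i) := Measure.pi μ

/-- The joint law of `(X, X')`, where `X'` is an independent copy of `X`. -/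
def pairLaw (μ : ∀ i, Measure (𝒳 i)) : Measure ((∀ i, 𝒳 i) × (∀ i, 𝒳 i)) :=
  (inputLaw μ).prod (inputLaw μ)

/-- The closed Sobol index `Var (E (Y | X_i, i ∈ u)) / Var Y` of the output `Y = f X`.
The σ-algebra `cylinderEvents u` is the one generated by the coordinates in `u`. -/
def closedSobol (μ : ∀ i, Measure (𝒳 i)) (f : (∀ i, 𝒳 i) → ℝ) (u : Finset (Fin p)) : ℝ :=
  Var[(inputLaw μ)[f | cylinderEvents (u : Set (Fin p))]; inputLaw μ] / Var[f; inputLaw μ]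

/-- The centred output `Y - E Y`, as a random variable on the space of `(X, X')`. -/
def outputC (μ : ∀ i, Measure (𝒳 i)) (f : (∀ i, 𝒳 i) → ℝ) :
    (∀ i, 𝒳 i) × (∀ i, 𝒳 i) → ℝ :=
  fun z => f z.1 - ∫ y, f y.1 ∂(pairLaw μ)

/-- The centred pick-freeze output `Y^u - E Y^u`, as a random variable on the space of `(X, X')`. -/
def pickOutputC (μ : ∀ i, Measure (𝒳 i)) (f : (∀ i, 𝒳 i) → ℝ) (u : Finset (Fin p)) :
    (∀ i, 𝒳 i) × (∀ i, 𝒳 i) → ℝ :=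
  fun z => f (pickFreeze u z.1 z.2) - ∫ y, f (pickFreeze u y.1 y.2) ∂(pairLaw μ)

/-- The limiting covariance matrix of the pick-freeze estimators of a finite family `t` of closed
Sobol indices. -/
def sobolCov {ι : Type*} (μ : ∀ i, Measure (𝒳 i)) (f : (∀ i, 𝒳 i) → ℝ) (t : ι → Finset (Fin p)) :
    Matrix ι ι ℝ :=
  Matrix.of fun a b =>
    (cov[outputC μ f * pickOutputC μ f (t a), outputC μ f * pickOutputC μ f (t b); pairLaw μ]
      - closedSobol μ f (t a) * cov[outputC μ f * pickOutputC μ f (t b), outputC μ f ^ 2; pairLaw μ]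
      - closedSobol μ f (t b) * cov[outputC μ f * pickOutputC μ f (t a), outputC μ f ^ 2; pairLaw μ]
      + closedSobol μ f (t b) * closedSobol μ f (t a) * Var[outputC μ f ^ 2; pairLaw μ])
    / Var[f; inputLaw μ] ^ 2

/-- The matrix of the linear map `(a, b, c) ↦ (a, b - c)` from `ℝ^(k+l+l)` to `ℝ^(k+l)`. -/
def contrastMatrix (k l : ℕ) : Matrix (Fin k ⊕ Fin l) (Fin k ⊕ (Fin l ⊕ Fin l)) ℝ :=
  Matrix.fromBlocks 1 0 0 (Matrix.fromCols 1 (-1))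

/-- The covariance matrix `Γ = A Σ Aᵀ`, where `Σ` is the limiting covariance matrix of the estimators
for the concatenated family `(u, v, w)` and `A` maps `(a, b, c)` to `(a, b - c)`. -/
def testCov {k l : ℕ} (μ : ∀ i, Measure (𝒳 i)) (f : (∀ i, 𝒳 i) → ℝ)
    (u : Fin k → Finset (Fin p)) (v w : Fin l → Finset (Fin p)) :
    Matrix (Fin k ⊕ Fin l) (Fin k ⊕ Fin l) ℝ :=
  contrastMatrix k l * sobolCov μ f (Sum.elim u (Sum.elim v w)) * (contrastMatrix k l).transpose

/-- The null hypothesis: `S^u = 0` and `S^v = S^w`. -/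
def NullHypothesis {k l : ℕ} (μ : ∀ i, Measure (𝒳 i)) (f : (∀ i, 𝒳 i) → ℝ)
    (u : Fin k → Finset (Fin p)) (v w : Fin l → Finset (Fin p)) : Prop :=
  (∀ a, closedSobol μ f (u a) = 0) ∧ ∀ b, closedSobol μ f (v b) = closedSobol μ f (w b)

end Model

end

end SobolTest

/-!
The argument rests on one identity and one limit theorem.

*Identity.* Averaging `f (pickFreeze u x x')` over `x'` gives the conditional expectation of `Y`
given the coordinates in `u` (`condExp_cylinderEvents_ae_eq`), so `Cov (Y, Y^u) = Var (E (Y | X_u))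
= S^u * Var Y` (`covariance_pickFreeze`). Hence `S_N^u` is an empirical covariance divided by an
empirical variance and converges almost surely to `S^u` by the strong law of large numbers
(`ae_tendsto_sobolEstimator`). Under the alternative some coordinate of `A S_N` has a nonzero limit,
and the factor `√N` sends its absolute value to infinity.

*Limit theorem.* By the Cramér–Wold device (`tendstoInDistribution_of_inner`), convergence of the
test statistic reduces to that of `√N ∑ c a * S_N^(t a)` with `c = Aᵀ s`. The numerator of the
estimator is linear in the pick-freeze output, so this sum is `√N` times the empirical regression
coefficient on `Y` of the single variable `h = ∑ c a • Y^(t a)`, and under the null hypothesis `h`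
is uncorrelated with `Y`. No delta method is needed: the empirical covariance of `Y` and `h` is the
mean of the centred variables `(Y - E Y) (h - E h)` minus a product of two centred empirical means,
the latter being negligible even after multiplication by `√N`
(`tendstoInDistribution_sqrt_mul_empCov`), and Slutsky's theorem takes care of the denominator.
The limiting variance is the quadratic form of `Γ` at `s` (`dotProduct_sobolCov_mulVec`,
`dotProduct_testCov_mulVec`); being a variance, it is nonnegative, which makes `Γ` positive
semidefinite (`posSemidef_testCov`) with no assumption on the indices.
-/

open scoped NNReal ENNReal RealInnerProductSpace Matrix

namespace SobolTest

/-! ### The pick-freeze identity -/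

section Model

variable {p : ℕ} {𝒳 : Fin p → Type*} [∀ i, MeasurableSpace (𝒳 i)]

instance (μ : ∀ i, Measure (𝒳 i)) [∀ i, IsProbabilityMeasure (μ i)] :
    IsProbabilityMeasure (inputLaw μ) := by
  unfold inputLaw; infer_instance

instance (μ : ∀ i, Measure (𝒳 i)) [∀ i, IsProbabilityMeasure (μ i)] :
    IsProbabilityMeasure (pairLaw μ) := by
  unfold pairLaw; infer_instance

lemma measurable_pickFreeze (u : Finset (Fin p)) :
    Measurable fun z : (∀ i, 𝒳 i) × (∀ i, 𝒳 i) => pickFreeze u z.1 z.2 := by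
  refine measurable_pi_iff.2 fun i => ?_
  by_cases hi : i ∈ u
  · simpa only [pickFreeze, hi, if_true, Function.comp_def] using
      (measurable_pi_apply i).comp measurable_fst
  · simpa only [pickFreeze, hi, if_false, Function.comp_def] using
      (measurable_pi_apply i).comp measurable_snd

/-- As a function of `x`, the pick-freeze vector only uses the coordinates in `u`. -/
lemma measurable_pickFreeze_cylinderEvents (u : Finset (Fin p)) :
    @Measurable _ _ (.prod (cylinderEvents (u : Set (Fin p))) MeasurableSpace.pi) _
      fun z : (∀ i, 𝒳 i) × (∀ i, 𝒳 i) => pickFreeze u z.1 z.2 := by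
  refine (@measurable_pi_iff _ _ _ (.prod (cylinderEvents (u : Set (Fin p))) MeasurableSpace.pi)
    _ _).2 fun i => ?_
  by_cases hi : i ∈ u
  · simp only [pickFreeze, hi, if_true]
    exact (measurable_cylinderEvent_apply (Finset.mem_coe.2 hi)).comp
      (@measurable_fst _ _ (cylinderEvents (u : Set (Fin p))) _)
  · simp only [pickFreeze, hi, if_false]
    exact (measurable_pi_apply i).comp
      (@measurable_snd _ _ (cylinderEvents (u : Set (Fin p))) _)

/-- An event generated by the coordinates in `u` does not see the coordinates which are resampled
by the pick-freeze operation. -/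
lemma pickFreeze_mem_iff {u : Finset (Fin p)} {s : Set (∀ i, 𝒳 i)}
    (hs : MeasurableSet[cylinderEvents (u : Set (Fin p))] s) (x x' : ∀ i, 𝒳 i) :
    pickFreeze u x x' ∈ s ↔ x ∈ s := by
  have hle : cylinderEvents (u : Set (Fin p)) ≤
      MeasurableSpace.comap (fun (x : ∀ i, 𝒳 i) (i : u) => x i) MeasurableSpace.pi := by
    refine iSup₂_le fun i hi => ?_
    rintro _ ⟨t, ht, rfl⟩
    exact ⟨(fun y => y ⟨i, hi⟩) ⁻¹' t, measurable_pi_apply (⟨i, hi⟩ : u) ht, rfl⟩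
  obtain ⟨t, -, rfl⟩ := hle s hs
  have : (fun i : u => pickFreeze u x x' i) = fun i : u => x i := by
    funext i; simp [pickFreeze]
  simp [Set.mem_preimage, this]

variable (μ : ∀ i, Measure (𝒳 i)) [∀ i, IsProbabilityMeasure (μ i)]

/-- The pick-freeze vector has the law of the input, since that law is a product measure. -/
lemma measurePreserving_pickFreeze (u : Finset (Fin p)) :
    MeasurePreserving (fun z : (∀ i, 𝒳 i) × (∀ i, 𝒳 i) => pickFreeze u z.1 z.2)
      (pairLaw μ) (inputLaw μ) where
  measurable := measurable_pickFreeze u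
  map_eq := by
    refine (Measure.pi_eq fun s hs => ?_).symm
    have hpre : (fun z : (∀ i, 𝒳 i) × (∀ i, 𝒳 i) => pickFreeze u z.1 z.2) ⁻¹' Set.univ.pi s =
        (Set.univ.pi fun i => if i ∈ u then s i else Set.univ) ×ˢ
          (Set.univ.pi fun i => if i ∈ u then Set.univ else s i) := by
      ext z
      simp only [Set.mem_preimage, Set.mem_univ_pi, Set.mem_prod, pickFreeze, ← forall_and]
      refine forall_congr' fun i => ?_
      by_cases hi : i ∈ u <;> simp [hi]
    rw [Measure.map_apply (measurable_pickFreeze u) (.univ_pi hs), hpre, pairLaw,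
      Measure.prod_prod, inputLaw, Measure.pi_pi, Measure.pi_pi, ← Finset.prod_mul_distrib]
    refine Finset.prod_congr rfl fun i _ => ?_
    by_cases hi : i ∈ u <;> simp [hi]

lemma measurePreserving_fst_pairLaw : MeasurePreserving Prod.fst (pairLaw μ) (inputLaw μ) :=
  measurePreserving_fst

variable {f : (∀ i, 𝒳 i) → ℝ} (hf : Measurable f)

include hf in
/-- Averaging over the resampled coordinates is the conditional expectation given the frozen
ones. -/
lemma condExp_cylinderEvents_ae_eq (hfi : Integrable f (inputLaw μ)) (u : Finset (Fin p)) :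
    (inputLaw μ)[f | cylinderEvents (u : Set (Fin p))] =ᵐ[inputLaw μ]
      fun x => ∫ x', f (pickFreeze u x x') ∂(inputLaw μ) := by
  have hint : Integrable (fun z : (∀ i, 𝒳 i) × (∀ i, 𝒳 i) => f (pickFreeze u z.1 z.2))
      ((inputLaw μ).prod (inputLaw μ)) :=
    (measurePreserving_pickFreeze μ u).integrable_comp_of_integrable hfi
  have hmeas : StronglyMeasurable[cylinderEvents (u : Set (Fin p))]
      fun x => ∫ x', f (pickFreeze u x x') ∂(inputLaw μ) :=
    @StronglyMeasurable.integral_prod_right _ _ _ (cylinderEvents (u : Set (Fin p))) _ _ _ _ _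
      (fun x x' => f (pickFreeze u x x'))
      (hf.comp (measurable_pickFreeze_cylinderEvents u)).stronglyMeasurable
  refine (ae_eq_condExp_of_forall_setIntegral_eq cylinderEvents_le_pi hfi
    (fun s _ _ => hint.integral_prod_left.integrableOn) (fun s hs _ => ?_)
    hmeas.aestronglyMeasurable).symm
  have hs' : MeasurableSet s := cylinderEvents_le_pi s hs
  calc ∫ x in s, ∫ x', f (pickFreeze u x x') ∂(inputLaw μ) ∂(inputLaw μ)
    _ = ∫ z in s ×ˢ Set.univ, f (pickFreeze u z.1 z.2) ∂((inputLaw μ).prod (inputLaw μ)) := by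
      rw [setIntegral_prod _ hint.integrableOn]; simp
    _ = ∫ z in (fun z : (∀ i, 𝒳 i) × (∀ i, 𝒳 i) => pickFreeze u z.1 z.2) ⁻¹' s,
          f (pickFreeze u z.1 z.2) ∂(pairLaw μ) := by
      rw [show (fun z : (∀ i, 𝒳 i) × (∀ i, 𝒳 i) => pickFreeze u z.1 z.2) ⁻¹' s =
        s ×ˢ Set.univ from by ext z; simp [pickFreeze_mem_iff hs]]
      rfl
    _ = ∫ x in s, f x ∂(inputLaw μ) := by
      rw [← (measurePreserving_pickFreeze μ u).map_eq, setIntegral_map hs'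
        hf.aestronglyMeasurable (measurable_pickFreeze u).aemeasurable]

include hf in
/-- The closed Sobol index is the correlation of the output with its pick-freeze copy: conditionally
on the frozen coordinates, `Y` and `Y^u` are independent with the same law. -/
lemma covariance_pickFreeze (hf2 : MemLp f 2 (inputLaw μ)) (hvar : Var[f; inputLaw μ] ≠ 0)
    (u : Finset (Fin p)) :
    cov[fun z => f z.1, fun z => f (pickFreeze u z.1 z.2); pairLaw μ] =
      closedSobol μ f u * Var[f; inputLaw μ] := by
  have hfi : Integrable f (inputLaw μ) := hf2.integrable (by norm_num)
  have hmle : cylinderEvents (X := 𝒳) (u : Set (Fin p)) ≤ MeasurableSpace.pi := cylinderEvents_le_pi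
  have hpf := measurePreserving_pickFreeze μ u
  have hfst := measurePreserving_fst_pairLaw μ
  have h1 : MemLp (fun z => f z.1) 2 (pairLaw μ) := hf2.comp_measurePreserving hfst
  have h2 : MemLp (fun z : (∀ i, 𝒳 i) × (∀ i, 𝒳 i) => f (pickFreeze u z.1 z.2)) 2 (pairLaw μ) :=
    hf2.comp_measurePreserving hpf
  have hae := condExp_cylinderEvents_ae_eq μ hf hfi u
  have hL2 : MemLp ((inputLaw μ)[f | cylinderEvents (u : Set (Fin p))]) 2 (inputLaw μ) :=
    hf2.condExp one_le_two
  -- Integrating out `x'` turns `Y^u` into `E (Y | X_u)`, and the tower property then does the same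
  -- to `Y`.
  have key : ∫ z, f z.1 * f (pickFreeze u z.1 z.2) ∂(pairLaw μ) =
      ∫ x, ((inputLaw μ)[f | cylinderEvents (u : Set (Fin p))]) x ^ 2 ∂(inputLaw μ) := by
    calc ∫ z, f z.1 * f (pickFreeze u z.1 z.2) ∂(pairLaw μ)
      _ = ∫ x, f x * ∫ x', f (pickFreeze u x x') ∂(inputLaw μ) ∂(inputLaw μ) := by
        rw [pairLaw, integral_prod (fun z => f z.1 * f (pickFreeze u z.1 z.2))
          (h1.integrable_mul h2)]
        simp [integral_const_mul]
      _ = ∫ x, (f * (inputLaw μ)[f | cylinderEvents (u : Set (Fin p))]) x ∂(inputLaw μ) := by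
        refine integral_congr_ae ?_
        filter_upwards [hae] with x hx
        rw [Pi.mul_apply, hx]
      _ = ∫ x, ((inputLaw μ)[f * (inputLaw μ)[f | cylinderEvents (u : Set (Fin p))] |
          cylinderEvents (u : Set (Fin p))]) x ∂(inputLaw μ) :=
        (integral_condExp hmle).symm
      _ = ∫ x, ((inputLaw μ)[f | cylinderEvents (u : Set (Fin p))]) x ^ 2 ∂(inputLaw μ) := by
        refine integral_congr_ae ?_
        filter_upwards [condExp_mul_of_stronglyMeasurable_right stronglyMeasurable_condExp
          (hf2.integrable_mul hL2) hfi] with x hx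
        rw [hx, Pi.mul_apply, sq]
  have e1 : ∫ z, f z.1 ∂(pairLaw μ) = ∫ x, f x ∂(inputLaw μ) :=
    hfst.hasLaw.integral_comp hf.aestronglyMeasurable
  have e2 : ∫ z, f (pickFreeze u z.1 z.2) ∂(pairLaw μ) = ∫ x, f x ∂(inputLaw μ) :=
    hpf.hasLaw.integral_comp hf.aestronglyMeasurable
  rw [closedSobol, div_mul_cancel₀ _ hvar, covariance_eq_sub h1 h2, variance_eq_sub hL2]
  simp only [Pi.mul_apply, Pi.pow_apply]
  rw [key, e1, e2, integral_condExp hmle, sq (∫ x, f x ∂(inputLaw μ))]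

end Model

/-! ### Convergence in distribution -/

section Convergence

variable {Ω Ω' : Type*} {mΩ : MeasurableSpace Ω} {mΩ' : MeasurableSpace Ω'}
  {P : Measure Ω} {P' : Measure Ω'}

lemma charFun_map_inner_one {E : Type*} [NormedAddCommGroup E] [InnerProductSpace ℝ E]
    [SecondCountableTopology E] [MeasurableSpace E] [BorelSpace E] {W : Ω → E}
    (hW : AEMeasurable W P) (t : E) :
    charFun (P.map fun ω => ⟪W ω, t⟫) 1 = charFun (P.map W) t := by
  rw [charFun_apply, charFun_apply, integral_map hW (by fun_prop),
    integral_map (by fun_prop) (by fun_prop)]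
  simp

variable [IsProbabilityMeasure P] [IsProbabilityMeasure P']

/-- Convergence in distribution to a constant implies convergence in probability. -/
lemma tendstoInMeasure_of_tendstoInDistribution_const {T : ℕ → Ω → ℝ} {c : ℝ}
    (h : TendstoInDistribution T atTop (fun _ : Ω' => c) (fun _ => P) P') :
    TendstoInMeasure P T atTop fun _ => c := by
  rw [tendstoInMeasure_iff_norm]
  intro ε hε
  have hF : IsClosed {x : ℝ | ε ≤ ‖x - c‖} :=
    isClosed_le continuous_const (by fun_prop)
  have hlim := ProbabilityMeasure.limsup_measure_closed_le_of_tendsto h.tendsto hF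
  simp only [ProbabilityMeasure.coe_mk] at hlim
  have h0 : P'.map (fun _ : Ω' => c) {x : ℝ | ε ≤ ‖x - c‖} = 0 := by
    rw [Measure.map_apply measurable_const hF.measurableSet]
    simp [hε.not_ge]
  rw [h0] at hlim
  have hT (N : ℕ) : P.map (T N) {x : ℝ | ε ≤ ‖x - c‖} = P {ω | ε ≤ ‖T N ω - c‖} := by
    rw [Measure.map_apply_of_aemeasurable (h.forall_aemeasurable N) hF.measurableSet]
    rfl
  simp only [hT] at hlim
  exact tendsto_of_le_liminf_of_limsup_le bot_le hlim

/-- The **Cramér–Wold device**: the characteristic function of `T` at `t` is the one of `⟪T, t⟫`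
at `1`, so that Lévy's convergence theorem applies. -/
lemma tendstoInDistribution_of_inner {E : Type*} [NormedAddCommGroup E] [InnerProductSpace ℝ E]
    [FiniteDimensional ℝ E] [MeasurableSpace E] [BorelSpace E] {T : ℕ → Ω → E} {Z : Ω' → E}
    (hT : ∀ N, AEMeasurable (T N) P) (hZ : AEMeasurable Z P')
    (h : ∀ t : E, TendstoInDistribution (fun N ω => ⟪T N ω, t⟫) atTop (fun ω => ⟪Z ω, t⟫)
      (fun _ => P) P') :
    TendstoInDistribution T atTop Z (fun _ => P) P' where
  forall_aemeasurable := hT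
  aemeasurable_limit := hZ
  tendsto := by
    refine ProbabilityMeasure.tendsto_iff_tendsto_charFun.2 fun t => ?_
    have ht := ProbabilityMeasure.tendsto_iff_tendsto_charFun.1 (h t).tendsto 1
    simp only [ProbabilityMeasure.coe_mk] at ht ⊢
    rw [charFun_map_inner_one hZ t] at ht
    exact ht.congr fun N => charFun_map_inner_one (hT N) t

end Convergence

/-! ### Empirical means and covariances of independent samples -/

/-- The empirical covariance of the first `N` terms of two sequences, normalised by `N` and not by
`N - 1`. -/
noncomputable def empCov (N : ℕ) (y h : ℕ → ℝ) : ℝ :=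
  empMean N (fun n => y n * h n) - empMean N y * empMean N h

lemma empCov_sum {ι : Type*} [Fintype ι] (N : ℕ) (y : ℕ → ℝ) (c : ι → ℝ) (h : ι → ℕ → ℝ) :
    empCov N y (fun n => ∑ a, c a * h a n) = ∑ a, c a * empCov N y (h a) := by
  have e1 : ∑ n ∈ Finset.range N, y n * ∑ a, c a * h a n =
      ∑ a, c a * ∑ n ∈ Finset.range N, y n * h a n := by
    simp_rw [Finset.mul_sum]
    rw [Finset.sum_comm]
    exact Finset.sum_congr rfl fun a _ => Finset.sum_congr rfl fun n _ => by ring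
  have e2 : ∑ n ∈ Finset.range N, ∑ a, c a * h a n =
      ∑ a, c a * ∑ n ∈ Finset.range N, h a n := by
    rw [Finset.sum_comm]
    simp_rw [Finset.mul_sum]
  simp only [empCov, empMean, e1, e2]
  rw [Finset.mul_sum, Finset.mul_sum Finset.univ _ (1 / (N : ℝ)), Finset.mul_sum Finset.univ,
    ← Finset.sum_sub_distrib]
  exact Finset.sum_congr rfl fun a _ => by ring

/-- Shifting the two sequences by constants does not change their empirical covariance. For `b`, `c`
the means of `y`, `h`, the right-hand side is a normalised sum of centred variables minus a product
of a normalised sum and an empirical mean tending to `0`. Both sides vanish for `N = 0`. -/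
lemma sqrt_mul_empCov (N : ℕ) (y h : ℕ → ℝ) (b c : ℝ) :
    √(N : ℝ) * empCov N y h =
      (√(N : ℝ))⁻¹ * ∑ n ∈ Finset.range N, (y n - b) * (h n - c)
        - ((√(N : ℝ))⁻¹ * ∑ n ∈ Finset.range N, (y n - b)) * empMean N (fun n => h n - c) := by
  rcases Nat.eq_zero_or_pos N with rfl | hN
  · simp
  have hs : √(N : ℝ) ≠ 0 := by positivity
  have hN' : (N : ℝ) = √(N : ℝ) * √(N : ℝ) := (Real.mul_self_sqrt (by positivity)).symm
  have e : ∑ n ∈ Finset.range N, (y n - b) * (h n - c) =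
      ∑ n ∈ Finset.range N, y n * h n - c * ∑ n ∈ Finset.range N, y n
        - b * ∑ n ∈ Finset.range N, h n + N * (b * c) := by
    have : ∀ n, (y n - b) * (h n - c) = y n * h n - c * y n - b * h n + b * c := fun n => by ring
    simp [this, Finset.sum_add_distrib, Finset.sum_sub_distrib, ← Finset.mul_sum]
  rw [e]
  simp only [empCov, empMean, Finset.sum_sub_distrib, Finset.sum_const, Finset.card_range,
    nsmul_eq_mul]
  generalize √(N : ℝ) = r at *
  rw [hN']
  field_simp
  ring

lemma holderTriple_four_four_two : ENNReal.HolderTriple 4 4 2 := ⟨by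
  rw [show (4 : ℝ≥0∞) = 2 * 2 by norm_num, ENNReal.mul_inv (by simp) (by simp), ← mul_add,
    ENNReal.inv_two_add_inv_two, mul_one]⟩

section Sampling

variable {Ω S : Type*} [MeasurableSpace Ω] [MeasurableSpace S]
  {P : Measure Ω} {ν : Measure S} {ξ : ℕ → Ω → S} (hlaw : ∀ n, HasLaw (ξ n) ν P)

include hlaw in
lemma identDistrib_comp {g : S → ℝ} (hg : Measurable g) (n : ℕ) :
    IdentDistrib (fun ω => g (ξ n ω)) (fun ω => g (ξ 0 ω)) P P :=
  IdentDistrib.comp ⟨(hlaw n).aemeasurable, (hlaw 0).aemeasurable,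
    (hlaw n).map_eq.trans (hlaw 0).map_eq.symm⟩ hg

include hlaw in
lemma memLp_comp_hasLaw {g : S → ℝ} {q : ℝ≥0∞} (hg : MemLp g q ν) (n : ℕ) :
    MemLp (fun ω => g (ξ n ω)) q P := by
  rw [← (hlaw n).map_eq] at hg
  exact hg.comp_of_map (hlaw n).aemeasurable

include hlaw in
lemma aemeasurable_empMean {g : S → ℝ} (hg : Measurable g) (N : ℕ) :
    AEMeasurable (fun ω => empMean N fun n => g (ξ n ω)) P :=
  (Finset.aemeasurable_fun_sum _ fun n _ => hg.comp_aemeasurable (hlaw n).aemeasurable).const_mul _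

include hlaw in
lemma aemeasurable_empCov {y h : S → ℝ} (hy : Measurable y) (hh : Measurable h) (N : ℕ) :
    AEMeasurable (fun ω => empCov N (fun n => y (ξ n ω)) fun n => h (ξ n ω)) P :=
  (aemeasurable_empMean hlaw (hy.mul hh) N).sub
    ((aemeasurable_empMean hlaw hy N).mul (aemeasurable_empMean hlaw hh N))

variable (hindep : iIndepFun ξ P)

include hlaw hindep in
lemma ae_tendsto_empMean {g : S → ℝ} (hg : Measurable g) (hgi : Integrable g ν) :
    ∀ᵐ ω ∂P, Tendsto (fun N => empMean N fun n => g (ξ n ω)) atTop (𝓝 (∫ s, g s ∂ν)) := by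
  have hint : Integrable (fun ω => g (ξ 0 ω)) P :=
    memLp_one_iff_integrable.1 (memLp_comp_hasLaw hlaw (memLp_one_iff_integrable.2 hgi) 0)
  have h := strong_law_ae_real (fun n ω => g (ξ n ω)) hint
    (fun i j hij => (hindep.comp (fun _ => g) fun _ => hg).indepFun hij)
    (identDistrib_comp hlaw hg)
  have e : ∫ ω, g (ξ 0 ω) ∂P = ∫ s, g s ∂ν := (hlaw 0).integral_comp hg.aestronglyMeasurable
  filter_upwards [h] with ω hω
  rw [e] at hω
  refine hω.congr fun N => ?_
  rw [empMean, one_div, div_eq_inv_mul]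

include hlaw hindep in
lemma ae_tendsto_empCov {y h : S → ℝ} (hy : Measurable y) (hh : Measurable h)
    [IsProbabilityMeasure ν] (hy2 : MemLp y 2 ν) (hh2 : MemLp h 2 ν) :
    ∀ᵐ ω ∂P, Tendsto (fun N => empCov N (fun n => y (ξ n ω)) fun n => h (ξ n ω)) atTop
      (𝓝 cov[y, h; ν]) := by
  filter_upwards [ae_tendsto_empMean hlaw hindep (hy.mul hh) (hy2.integrable_mul hh2),
    ae_tendsto_empMean hlaw hindep hy (hy2.integrable (by norm_num)),
    ae_tendsto_empMean hlaw hindep hh (hh2.integrable (by norm_num))] with ω h1 h2 h3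
  rw [covariance_eq_sub hy2 hh2]
  exact h1.sub (h2.mul h3)

variable [IsProbabilityMeasure P]

include hlaw hindep in
lemma tendstoInDistribution_inv_sqrt_mul_sum_comp {Ω' : Type*} [MeasurableSpace Ω']
    {P' : Measure Ω'} [IsProbabilityMeasure P'] {Z : Ω' → ℝ} {g : S → ℝ} (hg : Measurable g)
    (hg2 : MemLp g 2 ν) (hg0 : ∫ s, g s ∂ν = 0)
    (hZ : HasLaw Z (gaussianReal 0 Var[g; ν].toNNReal) P') :
    TendstoInDistribution (fun (N : ℕ) ω => (√(N : ℝ))⁻¹ * ∑ n ∈ Finset.range N, g (ξ n ω))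
      atTop Z (fun _ => P) P' := by
  have e : ∫ ω, g (ξ 0 ω) ∂P = ∫ s, g s ∂ν := (hlaw 0).integral_comp hg.aestronglyMeasurable
  have ev : Var[fun ω => g (ξ 0 ω); P] = Var[g; ν] := by
    have hg' : AEMeasurable (fun ω => g (ξ 0 ω)) P := hg.comp_aemeasurable (hlaw 0).aemeasurable
    rw [← covariance_self hg',
      (hlaw 0).covariance_fun_comp hg.aemeasurable hg.aemeasurable,
      covariance_self hg.aemeasurable]
  rw [← ev] at hZ
  have h := tendstoInDistribution_inv_sqrt_mul_sum_sub (X := fun n ω => g (ξ n ω)) hZ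
    (memLp_comp_hasLaw hlaw hg2 0) (hindep.comp (fun _ => g) fun _ => hg)
    (identDistrib_comp hlaw hg)
  simpa [e, hg0] using h

variable [IsProbabilityMeasure ν]

include hlaw hindep in
/-- The central limit theorem for the empirical covariance of two uncorrelated variables. Centring
by the empirical means instead of the true ones costs `√N` times a product of two empirical means
of centred variables, which is negligible since one of the factors absorbs `√N`. -/
lemma tendstoInDistribution_sqrt_mul_empCov {Ω' : Type*} [MeasurableSpace Ω']
    {P' : Measure Ω'} [IsProbabilityMeasure P'] {Z : Ω' → ℝ} {y h : S → ℝ} (hy : Measurable y)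
    (hh : Measurable h) (hy4 : MemLp y 4 ν) (hh4 : MemLp h 4 ν) (hcov : cov[y, h; ν] = 0)
    (hZ : HasLaw Z
      (gaussianReal 0 Var[fun s => (y s - ν[y]) * (h s - ν[h]); ν].toNNReal) P') :
    TendstoInDistribution
      (fun (N : ℕ) ω => √(N : ℝ) * empCov N (fun n => y (ξ n ω)) fun n => h (ξ n ω))
      atTop Z (fun _ => P) P' := by
  have hyc : MemLp (fun s => y s - ν[y]) 4 ν := hy4.sub (memLp_const _)
  have hhc : MemLp (fun s => h s - ν[h]) 4 ν := hh4.sub (memLp_const _)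
  have hyi : Integrable y ν := hy4.integrable (by norm_num)
  have hhi : Integrable h ν := hh4.integrable (by norm_num)
  have hmy : Measurable fun s => y s - ν[y] := hy.sub_const _
  have hmh : Measurable fun s => h s - ν[h] := hh.sub_const _
  have := holderTriple_four_four_two
  have hprod : MemLp (fun s => (y s - ν[y]) * (h s - ν[h])) 2 ν := hhc.mul hyc
  have hy0 : ∫ s, (y s - ν[y]) ∂ν = 0 := by
    rw [integral_sub hyi (integrable_const _)]; simp
  have hh0 : ∫ s, (h s - ν[h]) ∂ν = 0 := by
    rw [integral_sub hhi (integrable_const _)]; simp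
  -- The mean of the product of the centred variables is by definition their covariance, so `hcov`
  -- says that these products are centred.
  have main := tendstoInDistribution_inv_sqrt_mul_sum_comp hlaw hindep (hmy.mul hmh) hprod hcov hZ
  have hlin := tendstoInDistribution_inv_sqrt_mul_sum_comp hlaw hindep hmy
    (hyc.mono_exponent (by norm_num)) hy0 (HasLaw.id (μ := gaussianReal 0 _))
  have hmean : TendstoInMeasure P (fun N ω => empMean N fun n => h (ξ n ω) - ν[h]) atTop
      fun _ => 0 := by
    refine tendstoInMeasure_of_tendsto_ae
      (fun N => (aemeasurable_empMean hlaw hmh N).aestronglyMeasurable) ?_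
    have := ae_tendsto_empMean hlaw hindep hmh (hhi.sub (integrable_const _))
    rwa [hh0] at this
  have hrem := hlin.continuous_comp_prodMk_of_tendstoInMeasure_const
    (g := fun q : ℝ × ℝ => -(q.1 * q.2)) (by fun_prop) hmean (aemeasurable_empMean hlaw hmh)
  simp only [mul_zero, neg_zero] at hrem
  have hsum := main.add_of_tendstoInMeasure_const
    (tendstoInMeasure_of_tendstoInDistribution_const hrem) hrem.forall_aemeasurable
  simp only [add_zero] at hsum
  convert hsum using 3 with N ω
  rw [sqrt_mul_empCov N _ _ ν[y] ν[h], Pi.add_apply, sub_eq_add_neg]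
  rfl

include hlaw hindep in
/-- The central limit theorem for the empirical regression coefficient of `h` on `y`, for
uncorrelated `y` and `h`. -/
lemma tendstoInDistribution_sqrt_mul_empCov_div {Ω' : Type*} [MeasurableSpace Ω']
    {P' : Measure Ω'} [IsProbabilityMeasure P'] {Z : Ω' → ℝ} {y h : S → ℝ} (hy : Measurable y)
    (hh : Measurable h) (hy4 : MemLp y 4 ν) (hh4 : MemLp h 4 ν) (hcov : cov[y, h; ν] = 0)
    (hvar : Var[y; ν] ≠ 0)
    (hZ : HasLaw Z (gaussianReal 0
      (Var[fun s => (y s - ν[y]) * (h s - ν[h]); ν] / Var[y; ν] ^ 2).toNNReal) P') :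
    TendstoInDistribution
      (fun (N : ℕ) ω => √(N : ℝ) * (empCov N (fun n => y (ξ n ω)) (fun n => h (ξ n ω)) /
        empCov N (fun n => y (ξ n ω)) fun n => y (ξ n ω)))
      atTop Z (fun _ => P) P' := by
  have hy2 : MemLp y 2 ν := hy4.mono_exponent (by norm_num)
  have hZ' : HasLaw (fun ω => Var[y; ν] * Z ω)
      (gaussianReal 0 Var[fun s => (y s - ν[y]) * (h s - ν[h]); ν].toNNReal) P' := by
    convert gaussianReal_const_mul hZ Var[y; ν] using 2
    · simp
    · rw [← NNReal.coe_inj]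
      simp only [NNReal.coe_mul, NNReal.coe_mk]
      rw [Real.coe_toNNReal _ (variance_nonneg _ _),
        Real.coe_toNNReal _ (div_nonneg (variance_nonneg _ _) (sq_nonneg _))]
      field_simp
  -- The inverse of the denominator converges, and multiplication by it is continuous everywhere,
  -- unlike division.
  have hden : TendstoInMeasure P
      (fun N ω => (empCov N (fun n => y (ξ n ω)) fun n => y (ξ n ω))⁻¹) atTop
      fun _ => Var[y; ν]⁻¹ := by
    refine tendstoInMeasure_of_tendsto_ae
      (fun N => (aemeasurable_empCov hlaw hy hy N).inv.aestronglyMeasurable) ?_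
    filter_upwards [ae_tendsto_empCov hlaw hindep hy hy hy2 hy2] with ω hω
    rw [covariance_self hy.aemeasurable] at hω
    exact hω.inv₀ hvar
  have h := (tendstoInDistribution_sqrt_mul_empCov hlaw hindep hy hh hy4 hh4 hcov
    hZ').continuous_comp_prodMk_of_tendstoInMeasure_const
    (g := fun q : ℝ × ℝ => q.1 * q.2) (by fun_prop) hden
    (fun N => (aemeasurable_empCov hlaw hy hy N).inv)
  convert h using 3 with N ω
  · rw [div_eq_mul_inv, mul_assoc]
  · field_simp

end Sampling

/-! ### The test statistic and its covariance as contrasts -/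

section Model

variable {p k l : ℕ} {𝒳 : Fin p → Type*}

lemma sobolEstimator_eq_empCov_div (f : (∀ i, 𝒳 i) → ℝ) (u : Finset (Fin p))
    (x x' : ℕ → ∀ i, 𝒳 i) (N : ℕ) :
    sobolEstimator f u x x' N =
      empCov N (fun n => f (x n)) (fun n => f (pickFreeze u (x n) (x' n))) /
        empCov N (fun n => f (x n)) (fun n => f (x n)) := by
  simp only [sobolEstimator, empCov, sq]

lemma testStatistic_eq_contrastMatrix_mulVec (f : (∀ i, 𝒳 i) → ℝ) (u : Fin k → Finset (Fin p))
    (v w : Fin l → Finset (Fin p)) (x x' : ℕ → ∀ i, 𝒳 i) (N : ℕ) :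
    testStatistic f u v w x x' N = WithLp.toLp 2 (√(N : ℝ) • (contrastMatrix k l *ᵥ
      fun a => sobolEstimator f (Sum.elim u (Sum.elim v w) a) x x' N)) := by
  ext (i | i) <;>
  simp [testStatistic, contrastMatrix, Matrix.mulVec, dotProduct, Matrix.one_apply, sub_eq_add_neg,
    Matrix.fromCols]

variable [∀ i, MeasurableSpace (𝒳 i)] (μ : ∀ i, Measure (𝒳 i))

lemma nullHypothesis_iff_contrastMatrix_mulVec (f : (∀ i, 𝒳 i) → ℝ) (u : Fin k → Finset (Fin p))
    (v w : Fin l → Finset (Fin p)) :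
    NullHypothesis μ f u v w ↔ contrastMatrix k l *ᵥ
      (fun a => closedSobol μ f (Sum.elim u (Sum.elim v w) a)) = 0 := by
  have e1 (a : Fin k) : (contrastMatrix k l *ᵥ
      (fun a => closedSobol μ f (Sum.elim u (Sum.elim v w) a))) (Sum.inl a) =
      closedSobol μ f (u a) := by
    simp [contrastMatrix, Matrix.mulVec, dotProduct, Matrix.one_apply]
  have e2 (b : Fin l) : (contrastMatrix k l *ᵥ
      (fun a => closedSobol μ f (Sum.elim u (Sum.elim v w) a))) (Sum.inr b) =
      closedSobol μ f (v b) - closedSobol μ f (w b) := by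
    simp [contrastMatrix, Matrix.mulVec, dotProduct, Matrix.one_apply, sub_eq_add_neg,
      Matrix.fromCols]
  simp [NullHypothesis, funext_iff, e1, e2, sub_eq_zero]

lemma dotProduct_testCov_mulVec (f : (∀ i, 𝒳 i) → ℝ) (u : Fin k → Finset (Fin p))
    (v w : Fin l → Finset (Fin p)) (s : Fin k ⊕ Fin l → ℝ) :
    s ⬝ᵥ (testCov μ f u v w *ᵥ s) = (s ᵥ* contrastMatrix k l) ⬝ᵥ
      (sobolCov μ f (Sum.elim u (Sum.elim v w)) *ᵥ (s ᵥ* contrastMatrix k l)) := by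
  rw [testCov, ← Matrix.mulVec_mulVec, ← Matrix.mulVec_mulVec, Matrix.dotProduct_mulVec,
    Matrix.mulVec_transpose]

lemma transpose_sobolCov (f : (∀ i, 𝒳 i) → ℝ) {κ : Type*} (t : κ → Finset (Fin p)) :
    (sobolCov μ f t).transpose = sobolCov μ f t := by
  ext a b
  simp only [sobolCov, Matrix.transpose_apply, Matrix.of_apply]
  rw [covariance_comm (outputC μ f * pickOutputC μ f (t b)) (outputC μ f * pickOutputC μ f (t a))]
  ring

variable [∀ i, IsProbabilityMeasure (μ i)] {f : (∀ i, 𝒳 i) → ℝ}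

/-- The quadratic form of the limiting covariance matrix is the normalised variance of
`∑ c a • (Ȳ Ȳ^(t a) - S^(t a) Ȳ²)`. -/
lemma dotProduct_sobolCov_mulVec (hf4 : MemLp f 4 (inputLaw μ)) {κ : Type*} [Fintype κ]
    (t : κ → Finset (Fin p)) (c : κ → ℝ) :
    c ⬝ᵥ (sobolCov μ f t *ᵥ c) =
      Var[fun z => ∑ a, c a * (outputC μ f z * pickOutputC μ f (t a) z
        - closedSobol μ f (t a) * outputC μ f z ^ 2); pairLaw μ] / Var[f; inputLaw μ] ^ 2 := by
  have := holderTriple_four_four_two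
  have hY : MemLp (outputC μ f) 4 (pairLaw μ) :=
    (hf4.comp_measurePreserving (measurePreserving_fst_pairLaw μ)).sub (memLp_const _)
  have hP (a : κ) : MemLp (outputC μ f * pickOutputC μ f (t a)) 2 (pairLaw μ) :=
    MemLp.mul ((hf4.comp_measurePreserving (measurePreserving_pickFreeze μ (t a))).sub
      (memLp_const _)) hY
  have hQ : MemLp (outputC μ f ^ 2) 2 (pairLaw μ) := by
    rw [sq]; exact hY.mul hY
  have hQ' (a : κ) : MemLp (closedSobol μ f (t a) • outputC μ f ^ 2) 2 (pairLaw μ) :=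
    hQ.const_smul _
  have hW (a : κ) : MemLp (outputC μ f * pickOutputC μ f (t a)
      - closedSobol μ f (t a) • outputC μ f ^ 2) 2 (pairLaw μ) := (hP a).sub (hQ' a)
  have hcov (a b : κ) : sobolCov μ f t a b = cov[outputC μ f * pickOutputC μ f (t a)
      - closedSobol μ f (t a) • outputC μ f ^ 2, outputC μ f * pickOutputC μ f (t b)
      - closedSobol μ f (t b) • outputC μ f ^ 2; pairLaw μ] / Var[f; inputLaw μ] ^ 2 := by
    rw [covariance_sub_left (hP a) (hQ' a) (hW b), covariance_sub_right (hP a) (hP b) (hQ' b),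
      covariance_sub_right (hQ' a) (hP b) (hQ' b), covariance_smul_left, covariance_smul_right,
      covariance_smul_left, covariance_smul_right,
      covariance_self hQ.aestronglyMeasurable.aemeasurable,
      covariance_comm (outputC μ f ^ 2) (outputC μ f * pickOutputC μ f (t b))]
    simp only [sobolCov, Matrix.of_apply]
    ring
  have hsum : (fun z => ∑ a, c a * (outputC μ f z * pickOutputC μ f (t a) z
      - closedSobol μ f (t a) * outputC μ f z ^ 2)) =
      ∑ a, c a • (outputC μ f * pickOutputC μ f (t a)
        - closedSobol μ f (t a) • outputC μ f ^ 2) := by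
    ext z; simp
  rw [hsum, variance_sum fun a => (hW a).const_smul (c a)]
  simp only [dotProduct, Matrix.mulVec, hcov, covariance_smul_left, covariance_smul_right,
    Finset.mul_sum, Finset.sum_div]
  exact Finset.sum_congr rfl fun a _ => Finset.sum_congr rfl fun b _ => by ring

lemma posSemidef_testCov (hf4 : MemLp f 4 (inputLaw μ)) (u : Fin k → Finset (Fin p))
    (v w : Fin l → Finset (Fin p)) : (testCov μ f u v w).PosSemidef := by
  refine Matrix.PosSemidef.of_dotProduct_mulVec_nonneg ?_ fun s => ?_
  · rw [Matrix.IsHermitian, Matrix.conjTranspose_eq_transpose_of_trivial, testCov,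
      Matrix.transpose_mul, Matrix.transpose_mul, Matrix.transpose_transpose, transpose_sobolCov,
      Matrix.mul_assoc]
  · rw [star_trivial, dotProduct_testCov_mulVec, dotProduct_sobolCov_mulVec μ hf4]
    exact div_nonneg (variance_nonneg _ _) (sq_nonneg _)

end Model

/-- A linear functional of a centred Gaussian vector is a centred Gaussian variable. -/
lemma hasLaw_inner_multivariateGaussian {ι : Type*} [Fintype ι] [DecidableEq ι]
    {S : Matrix ι ι ℝ} (hS : S.PosSemidef) (t : EuclideanSpace ℝ ι) :
    HasLaw (fun x : EuclideanSpace ℝ ι => ⟪x, t⟫)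
      (gaussianReal 0 (t ⬝ᵥ (S *ᵥ t)).toNNReal) (multivariateGaussian 0 S) where
  aemeasurable := by fun_prop
  map_eq := by
    have e : (fun x : EuclideanSpace ℝ ι => ⟪x, t⟫) = innerSL ℝ t := by
      ext x; rw [innerSL_apply_apply, real_inner_comm]
    rw [e, IsGaussian.map_eq_gaussianReal,
      ContinuousLinearMap.integral_comp_id_comm IsGaussian.integrable_id,
      integral_id_multivariateGaussian, map_zero,
      ← covarianceBilin_multivariateGaussian hS, covarianceBilin_self IsGaussian.memLp_two_id]
    congr

/-! ### Asymptotics of the estimators and of the test statistic -/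

section Estimator

variable {p k l : ℕ} {𝒳 : Fin p → Type*} [∀ i, MeasurableSpace (𝒳 i)]
  {μ : ∀ i, Measure (𝒳 i)} {f : (∀ i, 𝒳 i) → ℝ} (hf : Measurable f)
  {Ω : Type*} [MeasurableSpace Ω] {P : Measure Ω}
  {X X' : ℕ → Ω → ∀ i, 𝒳 i} (hlaw : ∀ n, HasLaw (fun ω => (X n ω, X' n ω)) (pairLaw μ) P)

include hf hlaw in
lemma aemeasurable_sobolEstimator (u : Finset (Fin p)) (N : ℕ) :
    AEMeasurable (fun ω => sobolEstimator f u (fun n => X n ω) (fun n => X' n ω) N) P := by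
  simp only [sobolEstimator_eq_empCov_div]
  exact (aemeasurable_empCov hlaw (hf.comp measurable_fst)
    (hf.comp (measurable_pickFreeze u)) N).div
      (aemeasurable_empCov hlaw (hf.comp measurable_fst) (hf.comp measurable_fst) N)

variable [∀ i, IsProbabilityMeasure (μ i)]
  (hindep : iIndepFun (fun n ω => (X n ω, X' n ω)) P)

lemma variance_comp_fst_pairLaw (hf : Measurable f) :
    Var[fun z => f z.1; pairLaw μ] = Var[f; inputLaw μ] := by
  have h1 : AEMeasurable (fun z : (∀ i, 𝒳 i) × (∀ i, 𝒳 i) => f z.1) (pairLaw μ) :=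
    (hf.comp measurable_fst).aemeasurable
  rw [← covariance_self h1, ← covariance_self hf.aemeasurable]
  exact (measurePreserving_fst_pairLaw μ).hasLaw.covariance_fun_comp hf.aemeasurable
    hf.aemeasurable

include hf hlaw hindep in
/-- Strong consistency of the pick-freeze estimator. -/
lemma ae_tendsto_sobolEstimator (hf2 : MemLp f 2 (inputLaw μ)) (hvar : Var[f; inputLaw μ] ≠ 0)
    (u : Finset (Fin p)) :
    ∀ᵐ ω ∂P, Tendsto (sobolEstimator f u (fun n => X n ω) (fun n => X' n ω)) atTop
      (𝓝 (closedSobol μ f u)) := by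
  have h1 : MemLp (fun z => f z.1) 2 (pairLaw μ) :=
    hf2.comp_measurePreserving (measurePreserving_fst_pairLaw μ)
  have h2 : MemLp (fun z : (∀ i, 𝒳 i) × (∀ i, 𝒳 i) => f (pickFreeze u z.1 z.2)) 2 (pairLaw μ) :=
    hf2.comp_measurePreserving (measurePreserving_pickFreeze μ u)
  have hm1 : Measurable fun z : (∀ i, 𝒳 i) × (∀ i, 𝒳 i) => f z.1 := hf.comp measurable_fst
  have hm2 : Measurable fun z : (∀ i, 𝒳 i) × (∀ i, 𝒳 i) => f (pickFreeze u z.1 z.2) :=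
    hf.comp (measurable_pickFreeze u)
  filter_upwards [ae_tendsto_empCov hlaw hindep hm1 hm2 h1 h2,
    ae_tendsto_empCov hlaw hindep hm1 hm1 h1 h1] with ω hn hd
  rw [covariance_self hm1.aemeasurable, variance_comp_fst_pairLaw hf] at hd
  have h := hn.div hd hvar
  rw [covariance_pickFreeze μ hf hf2 hvar u, mul_div_cancel_right₀ _ hvar] at h
  exact h.congr fun N => (sobolEstimator_eq_empCov_div f u _ _ N).symm

include hf hlaw hindep in
/-- The central limit theorem for a linear combination of pick-freeze estimators. A linear
combination of estimators is the estimator built on the linear combination `∑ c a • Y^(t a)`, which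
is uncorrelated with `Y` exactly when `∑ c a * S^(t a) = 0`. -/
lemma tendstoInDistribution_sum_sobolEstimator [IsProbabilityMeasure P]
    (hf4 : MemLp f 4 (inputLaw μ)) (hvar : Var[f; inputLaw μ] ≠ 0)
    {κ : Type*} [Fintype κ] (t : κ → Finset (Fin p)) (c : κ → ℝ)
    (hc : ∑ a, c a * closedSobol μ f (t a) = 0) {Ω' : Type*} [MeasurableSpace Ω']
    {P' : Measure Ω'} [IsProbabilityMeasure P'] {Z : Ω' → ℝ}
    (hZ : HasLaw Z (gaussianReal 0 (c ⬝ᵥ (sobolCov μ f t *ᵥ c)).toNNReal) P') :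
    TendstoInDistribution
      (fun (N : ℕ) ω => √(N : ℝ) * ∑ a, c a *
        sobolEstimator f (t a) (fun n => X n ω) (fun n => X' n ω) N)
      atTop Z (fun _ => P) P' := by
  have hf2 : MemLp f 2 (inputLaw μ) := hf4.mono_exponent (by norm_num)
  have hy4 : MemLp (fun z => f z.1) 4 (pairLaw μ) :=
    hf4.comp_measurePreserving (measurePreserving_fst_pairLaw μ)
  have ht4 (a : κ) : MemLp (fun z : (∀ i, 𝒳 i) × (∀ i, 𝒳 i) =>
      c a * f (pickFreeze (t a) z.1 z.2)) 4 (pairLaw μ) :=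
    (hf4.comp_measurePreserving (measurePreserving_pickFreeze μ (t a))).const_mul _
  have hmy : Measurable fun z : (∀ i, 𝒳 i) × (∀ i, 𝒳 i) => f z.1 := hf.comp measurable_fst
  have hmh : Measurable fun z : (∀ i, 𝒳 i) × (∀ i, 𝒳 i) =>
      ∑ a, c a * f (pickFreeze (t a) z.1 z.2) :=
    Finset.measurable_fun_sum _ fun a _ => (hf.comp (measurable_pickFreeze (t a))).const_mul _
  have hh4 : MemLp (fun z : (∀ i, 𝒳 i) × (∀ i, 𝒳 i) =>
      ∑ a, c a * f (pickFreeze (t a) z.1 z.2)) 4 (pairLaw μ) :=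
    memLp_finsetSum _ fun a _ => ht4 a
  have hcov : cov[fun z => f z.1, fun z => ∑ a, c a * f (pickFreeze (t a) z.1 z.2); pairLaw μ]
      = 0 := by
    rw [covariance_fun_sum_right (fun a => (ht4 a).mono_exponent (by norm_num))
      (hy4.mono_exponent (by norm_num))]
    simp only [covariance_const_mul_right, covariance_pickFreeze μ hf hf2 hvar, ← mul_assoc]
    rw [← Finset.sum_mul, hc, zero_mul]
  -- Since `∑ c a * S^(t a) = 0`, the terms in `Ȳ²` of the linearisation cancel.
  have hW : (fun z => ∑ a, c a * (outputC μ f z * pickOutputC μ f (t a) z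
      - closedSobol μ f (t a) * outputC μ f z ^ 2)) =
      fun z : (∀ i, 𝒳 i) × (∀ i, 𝒳 i) => (f z.1 - ∫ z, f z.1 ∂(pairLaw μ)) *
        ((∑ a, c a * f (pickFreeze (t a) z.1 z.2)) -
          ∫ z, ∑ a, c a * f (pickFreeze (t a) z.1 z.2) ∂(pairLaw μ)) := by
    funext z
    rw [integral_finsetSum _ fun a _ => (ht4 a).integrable (by norm_num),
      ← Finset.sum_sub_distrib, Finset.mul_sum]
    have e : ∑ a, c a * (outputC μ f z * pickOutputC μ f (t a) z
        - closedSobol μ f (t a) * outputC μ f z ^ 2) =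
        ∑ a, c a * (outputC μ f z * pickOutputC μ f (t a) z)
          - (∑ a, c a * closedSobol μ f (t a)) * outputC μ f z ^ 2 := by
      rw [Finset.sum_mul, ← Finset.sum_sub_distrib]
      exact Finset.sum_congr rfl fun a _ => by ring
    rw [e, hc, zero_mul, sub_zero]
    refine Finset.sum_congr rfl fun a _ => ?_
    rw [integral_const_mul, outputC, pickOutputC]
    ring
  rw [dotProduct_sobolCov_mulVec μ hf4, hW, ← variance_comp_fst_pairLaw hf] at hZ
  rw [← variance_comp_fst_pairLaw hf] at hvar
  convert tendstoInDistribution_sqrt_mul_empCov_div hlaw hindep hmy hmh hy4 hh4 hcov hvar hZ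
    using 4 with N ω
  simp only [sobolEstimator_eq_empCov_div]
  rw [empCov_sum N (fun n => f (X n ω)) c
    (fun a n => f (pickFreeze (t a) (X n ω) (X' n ω))), Finset.sum_div]
  exact Finset.sum_congr rfl fun a _ => (mul_div_assoc _ _ _).symm

include hf hlaw hindep in
/-- Under the null hypothesis, the pairing of the test statistic with `s` is `√N` times the
combination of the estimators with coefficients `Aᵀ s`, and `Aᵀ s` is orthogonal to the vector of
indices, so that no centring is needed. -/
lemma tendstoInDistribution_testStatistic [IsProbabilityMeasure P]
    (hf4 : MemLp f 4 (inputLaw μ)) (hvar : Var[f; inputLaw μ] ≠ 0)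
    (u : Fin k → Finset (Fin p)) (v w : Fin l → Finset (Fin p))
    (hnull : NullHypothesis μ f u v w) :
    TendstoInDistribution
      (fun (N : ℕ) (ω : Ω) => testStatistic f u v w (fun n => X n ω) (fun n => X' n ω) N)
      atTop id (fun _ => P) (multivariateGaussian 0 (testCov μ f u v w)) := by
  refine tendstoInDistribution_of_inner (fun N => ?_) aemeasurable_id fun s => ?_
  · refine (WithLp.measurable_toLp 2 _).comp_aemeasurable (aemeasurable_pi_iff.2 ?_)
    rintro (a | b)
    · exact (aemeasurable_sobolEstimator hf hlaw (u a) N).const_mul _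
    · exact ((aemeasurable_sobolEstimator hf hlaw (v b) N).sub
        (aemeasurable_sobolEstimator hf hlaw (w b) N)).const_mul _
  · have hZ := hasLaw_inner_multivariateGaussian (posSemidef_testCov μ hf4 u v w) s
    rw [dotProduct_testCov_mulVec] at hZ
    rw [nullHypothesis_iff_contrastMatrix_mulVec] at hnull
    have hc : (s ᵥ* contrastMatrix k l) ⬝ᵥ
        (fun a => closedSobol μ f (Sum.elim u (Sum.elim v w) a)) = 0 := by
      rw [← Matrix.dotProduct_mulVec, hnull, dotProduct_zero]
    simp only [id_eq]
    convert tendstoInDistribution_sum_sobolEstimator hf hlaw hindep hf4 hvar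
      (Sum.elim u (Sum.elim v w)) _ hc hZ using 3 with N ω
    change _ = √(N : ℝ) * ((s ᵥ* contrastMatrix k l) ⬝ᵥ fun a =>
      sobolEstimator f (Sum.elim u (Sum.elim v w) a) (fun n => X n ω) (fun n => X' n ω) N)
    rw [testStatistic_eq_contrastMatrix_mulVec, ← Matrix.dotProduct_mulVec,
      EuclideanSpace.inner_eq_star_dotProduct, star_trivial, dotProduct_smul, smul_eq_mul]

include hf hlaw hindep in
lemma ae_tendsto_norm_testStatistic_atTop
    (hf2 : MemLp f 2 (inputLaw μ)) (hvar : Var[f; inputLaw μ] ≠ 0)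
    (u : Fin k → Finset (Fin p)) (v w : Fin l → Finset (Fin p))
    (hnull : ¬ NullHypothesis μ f u v w) :
    ∀ᵐ ω ∂P, Tendsto
      (fun N : ℕ =>
        ‖firstBlock (testStatistic f u v w (fun n => X n ω) (fun n => X' n ω) N)‖
          + ‖secondBlock (testStatistic f u v w (fun n => X n ω) (fun n => X' n ω) N)‖)
      atTop atTop := by
  rw [nullHypothesis_iff_contrastMatrix_mulVec] at hnull
  obtain ⟨i, hi⟩ := Function.ne_iff.1 hnull
  filter_upwards [ae_all_iff.2 fun a => ae_tendsto_sobolEstimator hf hlaw hindep hf2 hvar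
    (Sum.elim u (Sum.elim v w) a)] with ω hω
  -- A contrast with nonzero limit is multiplied by `√N`.
  have hlim : Tendsto (fun N : ℕ => |testStatistic f u v w (fun n => X n ω) (fun n => X' n ω) N i|)
      atTop atTop := by
    have h1 : Tendsto (fun N : ℕ => (contrastMatrix k l *ᵥ fun a => sobolEstimator f
        (Sum.elim u (Sum.elim v w) a) (fun n => X n ω) (fun n => X' n ω) N) i) atTop
        (𝓝 ((contrastMatrix k l *ᵥ
          fun a => closedSobol μ f (Sum.elim u (Sum.elim v w) a)) i)) := by
      simp only [Matrix.mulVec, dotProduct]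
      exact tendsto_finsetSum _ fun a _ => (hω a).const_mul (contrastMatrix k l i a)
    have h2 : Tendsto (fun N : ℕ => √(N : ℝ)) atTop atTop :=
      Real.tendsto_sqrt_atTop.comp tendsto_natCast_atTop_atTop
    refine (h2.atTop_mul_pos (abs_pos.2 hi) h1.abs).congr fun N => ?_
    rw [testStatistic_eq_contrastMatrix_mulVec, PiLp.toLp_apply, Pi.smul_apply, smul_eq_mul,
      abs_mul, abs_of_nonneg (Real.sqrt_nonneg _)]
  refine tendsto_atTop_mono (fun N => ?_) hlim
  set g := testStatistic f u v w (fun n => X n ω) (fun n => X' n ω) N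
  rcases i with a | b
  · have h : |g (Sum.inl a)| ≤ ‖firstBlock g‖ := PiLp.norm_apply_le (firstBlock g) a
    exact h.trans (le_add_of_nonneg_right (norm_nonneg _))
  · have h : |g (Sum.inr b)| ≤ ‖secondBlock g‖ := PiLp.norm_apply_le (secondBlock g) b
    exact h.trans (le_add_of_nonneg_left (norm_nonneg _))

end Estimator

end SobolTest

theorem mainTheorem6 {p k l : ℕ} {𝒳 : Fin p → Type*} [∀ i, MeasurableSpace (𝒳 i)]
    (μ : ∀ i, Measure (𝒳 i)) [∀ i, IsProbabilityMeasure (μ i)]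
    (f : (∀ i, 𝒳 i) → ℝ) (hf : Measurable f)
    (hf2 : MemLp f 2 (SobolTest.inputLaw μ)) (hvar : Var[f; SobolTest.inputLaw μ] ≠ 0)
    (u : Fin k → Finset (Fin p)) (v w : Fin l → Finset (Fin p))
    {Ω : Type*} [MeasurableSpace Ω] (P : Measure Ω) [IsProbabilityMeasure P]
    (X X' : ℕ → Ω → ∀ i, 𝒳 i)
    (hlaw : ∀ n, HasLaw (fun ω => (X n ω, X' n ω)) (SobolTest.pairLaw μ) P)
    (hindep : iIndepFun (fun n ω => (X n ω, X' n ω)) P) :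
    (MemLp f 4 (SobolTest.inputLaw μ) →
      (SobolTest.testCov μ f u v w).PosSemidef ∧
      (SobolTest.NullHypothesis μ f u v w →
        TendstoInDistribution
          (fun (N : ℕ) (ω : Ω) =>
            SobolTest.testStatistic f u v w (fun n => X n ω) (fun n => X' n ω) N)
          atTop id (fun _ => P) (multivariateGaussian 0 (SobolTest.testCov μ f u v w)))) ∧
    (¬ SobolTest.NullHypothesis μ f u v w →
      ∀ᵐ ω ∂P, Tendsto
        (fun N : ℕ =>
          ‖SobolTest.firstBlock
              (SobolTest.testStatistic f u v w (fun n => X n ω) (fun n => X' n ω) N)‖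
            + ‖SobolTest.secondBlock
              (SobolTest.testStatistic f u v w (fun n => X n ω) (fun n => X' n ω) N)‖)
        atTop atTop) := by
  exact ⟨fun hf4 => ⟨SobolTest.posSemidef_testCov μ hf4 u v w, fun hnull =>
      SobolTest.tendstoInDistribution_testStatistic hf hlaw hindep hf4 hvar u v w hnull⟩,
    fun hnull => SobolTest.ae_tendsto_norm_testStatistic_atTop hf hlaw hindep hf2 hvar u v w hnull⟩
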